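/- Let $P=(P_n)_{n\in\mathbb N}$, $P_n:\{0,1\}^n\times\{0,1\}^n\to\{0,1\}^n$, be a strong pseudorandom permutation with security parameter (key length) $\lambda=n$. That is: for every key $k\in\{0,1\}^n$ the map $P_k=P_n(\cdot,k)$ is a permutation of $\{0,1\}^n$; the maps $(k,x)\mapsto P_k(x)$ and $(k,x)\mapsto P_k^{-1}(x)$ are computable in deterministic polynomial time; and for every probabilistic polynomial-time distinguisher $D$ with oracle access to a permutation and its inverse, $$\Bigl|\Pr_{k}\bigl[D^{P_k,P_k^{-1}}(1^n)=1\bigr]-\Pr_{\sigma}\bigl[D^{\sigma,\sigma^{-1}}(1^n)=1\bigr]\Bigr|\le \mathrm{negl}(n),$$ where $k$ is uniform in $\{0,1\}^n$, $\sigma$ is a uniformly random permutation of $\{0,1\}^n$, and the probabilities are also over the coins of $D$. Here a function $\nu:\mathbb N\to\mathbb R$ is negligible, written $\nu(n)=\mathrm{negl}(n)$, if $\nu(n)=o(n^{-c})$ for every constant $c$. For a key $k\in\{0,1\}^n$, $n\ge 1$, let $S=\{P_k(0i): i\in\{0,1\}^{n-1}\}$ be the image under $P_k$ of the strings whose first bit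 is $0$, let $\bar S=\{0,1\}^n\setminus S$, and let $O_{\mathrm{index}}:\{0,1\}^{n-1}\to\{0,1\}^n$, $O_{\mathrm{index}}(i)=P_k(0i)$, be the index oracle of $S$. Then for every probabilistic polynomial-time classical algorithm $A$ (input $1^n$) with query access to $O_{\mathrm{index}}$ (hence making polynomially many queries) there is a negligible function $\nu$ such that for all $n\ge 1$ $$\Pr\bigl[A^{O_{\mathrm{index}}}(1^n)\text{ outputs some } y\in\bar S\bigr]\le \tfrac12+\nu(n),$$ where the probability is over the uniformly random key $k\in\{0,1\}^n$ and the coins of $A$. -/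

import Mathlib

namespace ComplementSampling

/-- Bit strings of length `n`. -/
abbrev Bits (n : ℕ) : Type := List.Vector Bool n

/-- `ν n` is negligible: `ν n = o(1 / n ^ c)` for every constant `c`. -/
def Negligible (ν : ℕ → ℝ) : Prop :=
  Asymptotics.SuperpolynomialDecay Filter.atTop (fun n : ℕ => (n : ℝ)) ν

open Classical in
/-- The probability of the event `E` for a uniformly random element of the finite type `Ω`. -/
noncomputable def prob {Ω : Type} [Fintype Ω] (E : Ω → Prop) : ℝ :=
  ((Finset.univ.filter E).card : ℝ) / (Fintype.card Ω : ℝ)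

/-! ### Oracle machines -/

/-- Instructions of a machine with stacks `K` of bits, labels `Λ` and oracles `J`. -/
inductive Instr (J K Λ : Type) : Type
  /-- push the bit `b` on stack `k`, go to `l` -/
  | push (k : K) (b : Bool) (l : Λ)
  /-- pop stack `k`, go to the label that the popped bit determines (`none`: the stack is empty) -/
  | pop (k : K) (l : Option Bool → Λ)
  /-- replace the content of stack `k` by the answer of oracle `j` to it, go to `l` -/
  | ask (j : J) (k : K) (l : Λ)
  /-- stop -/
  | halt

/-- A machine with finitely many stacks of bits (equivalently, a multi-tape Turing machine), a
finite control, and access to oracles named by `J`. One stack initially holds the input, one holds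
the random coins, and the output is read off a third one, from the top. -/
structure OracleMachine (J : Type) where
  K : Type
  [decEqK : DecidableEq K]
  [finK : Fintype K]
  Λ : Type
  [finΛ : Fintype Λ]
  inputStack : K
  coinStack : K
  outputStack : K
  input_ne_coin : inputStack ≠ coinStack
  start : Λ
  prog : Λ → Instr J K Λ

namespace OracleMachine

variable {J : Type} (M : OracleMachine J)

/-- Configurations: the current label and the contents of the stacks (top first). -/
structure Cfg where
  label : M.Λ
  stack : M.K → List Bool

/-- One step of the machine with oracles `O`; a halted machine does not move. -/
def step (O : J → List Bool → List Bool) (c : M.Cfg) : M.Cfg :=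
  letI := M.decEqK
  match M.prog c.label with
  | .push k b l => ⟨l, Function.update c.stack k (b :: c.stack k)⟩
  | .pop k l => ⟨l (c.stack k).head?, Function.update c.stack k (c.stack k).tail⟩
  | .ask j k l => ⟨l, Function.update c.stack k (O j (c.stack k))⟩
  | .halt => c

/-- The initial configuration on input `1ⁿ` with coins `r`. -/
def init (n : ℕ) (r : List Bool) : M.Cfg :=
  letI := M.decEqK
  ⟨M.start, Function.update (Function.update (fun _ => []) M.inputStack (List.replicate n true))
    M.coinStack r⟩

/-- The configuration after `t` steps on input `1ⁿ` with coins `r`. -/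
def run (O : J → List Bool → List Bool) (n : ℕ) (r : List Bool) (t : ℕ) : M.Cfg :=
  (M.step O)^[t] (M.init n r)

/-- The machine has stopped. -/
def Halted (c : M.Cfg) : Prop := M.prog c.label = .halt

end OracleMachine

/-- A probabilistic polynomial-time algorithm with input `1ⁿ` and access to the oracles that
`oracles` attaches to a permutation of `{0,1}ⁿ`: a machine that uses `coins(n)` random bits and
stops within `time(n)` steps, for polynomials `coins` and `time`, whatever the permutation and the
random bits are. A query counts as one step. -/
structure PolyTimeAlgorithm {J : Type}
    (oracles : ∀ n : ℕ, Equiv.Perm (Bits n) → J → List Bool → List Bool)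
    extends OracleMachine J where
  coins : Polynomial ℕ
  time : Polynomial ℕ
  halts : ∀ (n : ℕ) (σ : Equiv.Perm (Bits n)) (r : Bits (coins.eval n)),
    toOracleMachine.Halted (toOracleMachine.run (oracles n σ) n r.toList (time.eval n))

/-- The output on input `1ⁿ` with the oracles attached to `σ` and coins `r`. -/
def PolyTimeAlgorithm.output {J : Type}
    {oracles : ∀ n : ℕ, Equiv.Perm (Bits n) → J → List Bool → List Bool}
    (A : PolyTimeAlgorithm oracles) (n : ℕ) (σ : Equiv.Perm (Bits n))
    (r : Bits (A.coins.eval n)) : List Bool :=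
  (A.toOracleMachine.run (oracles n σ) n r.toList (A.time.eval n)).stack A.outputStack

/-- The permutation `σ` as an oracle; queries that are not of length `n` are answered by the
empty string. -/
def applyPerm {n : ℕ} (σ : Equiv.Perm (Bits n)) (x : List Bool) : List Bool :=
  if h : x.length = n then (σ ⟨x, h⟩).toList else []

/-! ### Strong pseudorandom permutations -/

/-- The two directions in which a permutation can be queried. -/
inductive Direction : Type
  | forward
  | backward

/-- Oracle access to `σ` and to `σ⁻¹`. -/
def twoSidedOracle (n : ℕ) (σ : Equiv.Perm (Bits n)) : Direction → List Bool → List Bool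
  | .forward => applyPerm σ
  | .backward => applyPerm σ.symm

/-- The algorithm `D` accepts (outputs `1`): the first bit of its output is `1`. -/
def Accepts (D : PolyTimeAlgorithm twoSidedOracle) (n : ℕ) (σ : Equiv.Perm (Bits n))
    (r : Bits (D.coins.eval n)) : Prop :=
  (D.output n σ r).head? = some true

/-- For every `n`, a family of permutations of `{0,1}ⁿ` indexed by keys in `{0,1}ⁿ`. -/
abbrev KeyedPermutation : Type := ∀ n : ℕ, Bits n → Equiv.Perm (Bits n)

/-- A deterministic polynomial-time Turing machine computes `(k, x) ↦ F n k x`. -/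
def EfficientlyComputable (F : ∀ n : ℕ, Bits n → Bits n → Bits n) : Prop :=
  Nonempty (Turing.TM2ComputableInPolyTime
    (fun a : (Σ n : ℕ, Bits n × Bits n) => a.2.1.toList ++ a.2.2.toList)
    (fun b : List Bool => b)
    (fun a => (F a.1 a.2.1 a.2.2).toList))

/-- `P` is a strong pseudorandom permutation (with security parameter `n`): `P` and its inverse
are efficiently computable given the key, and no probabilistic polynomial-time distinguisher with
access to a permutation and its inverse tells `P` with a random key from a random permutation with
more than negligible advantage. -/
structure IsStrongPRP (P : KeyedPermutation) : Prop where
  efficient : EfficientlyComputable fun n k x => P n k x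
  efficient_inv : EfficientlyComputable fun n k x => (P n k).symm x
  indistinguishable : ∀ D : PolyTimeAlgorithm twoSidedOracle, ∃ ν : ℕ → ℝ, Negligible ν ∧
    ∀ n : ℕ,
      |prob (fun ω : Bits n × Bits (D.coins.eval n) => Accepts D n (P n ω.1) ω.2) -
        prob (fun ω : Equiv.Perm (Bits n) × Bits (D.coins.eval n) => Accepts D n ω.1 ω.2)| ≤ ν n

/-! ### Complement sampling -/

/-- The image under `σ` of the strings whose first bit is `0`. -/
def zeroImage {n : ℕ} (σ : Equiv.Perm (Bits n)) : Set (Bits n) :=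
  σ '' {x | x.toList.head? = some false}

/-- The index oracle of `zeroImage σ`: on the index `i ∈ {0,1}ⁿ⁻¹` it returns the element
`σ(0i)`; queries that are not of length `n - 1` are answered by the empty string. -/
def indexOracle (n : ℕ) (σ : Equiv.Perm (Bits n)) : Unit → List Bool → List Bool :=
  fun _ i => applyPerm σ (false :: i)

/-- With index-oracle access to `S = zeroImage σ`, the algorithm outputs an element of the
complement of `S` in `{0,1}ⁿ`. -/
def SamplesComplement (A : PolyTimeAlgorithm indexOracle) (n : ℕ) (σ : Equiv.Perm (Bits n))
    (r : Bits (A.coins.eval n)) : Prop :=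
  ∃ y ∈ (zeroImage σ)ᶜ, A.output n σ r = y.toList

end ComplementSampling

/-! Membership in the complement can be tested with one inverse query: `y` lies in it iff `σ⁻¹ y`
begins with `1`. So a sampler yields a distinguisher (`accepts_distinguisher_iff`), and its success
probability against `P` is negligibly close to that against a random `σ`.

For random `σ` (`card_samplesComplement_mul_le`), let the output be `σ(1j)` and let `i` be an
unqueried index. Exchanging the values of `σ` at `1j` and `0i` changes no answer seen, hence not the
output, which now lies in `S`. With `n = m + 1`, each success has at least `2^m - T` such exchanges,
and each failure arises from at most `2^m`, one for each `j`. Hence successes exceed half of all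
cases by a fraction of at most `T / 2^n`. -/

namespace ComplementSampling

/-! ### Runs of oracle machines and their dependence on the oracle -/

namespace OracleMachine

variable {J : Type} (M : OracleMachine J)

theorem step_of_halted (O : J → List Bool → List Bool) {c : M.Cfg} (h : M.Halted c) :
    M.step O c = c := by
  unfold Halted at h
  simp only [step, h]

theorem iterate_step_of_halted (O : J → List Bool → List Bool) {c : M.Cfg} (h : M.Halted c)
    (t : ℕ) : (M.step O)^[t] c = c :=
  Function.iterate_fixed (M.step_of_halted O h) t

theorem run_succ (O : J → List Bool → List Bool) (n : ℕ) (r : List Bool) (t : ℕ) :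
    M.run O n r (t + 1) = M.step O (M.run O n r t) :=
  Function.iterate_succ_apply' _ _ _

/-- A halted machine keeps its configuration. -/
theorem run_eq_of_halted (O : J → List Bool → List Bool) {n : ℕ} {r : List Bool} {s t : ℕ}
    (h : M.Halted (M.run O n r s)) (hst : s ≤ t) : M.run O n r t = M.run O n r s := by
  obtain ⟨d, rfl⟩ := Nat.exists_eq_add_of_le' hst
  unfold run at h ⊢
  rw [Function.iterate_add_apply, M.iterate_step_of_halted O h]

/-- The query that the machine makes in the configuration `c`; junk if it makes none. -/
def query (c : M.Cfg) : List Bool :=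
  match M.prog c.label with
  | .ask _ k _ => c.stack k
  | _ => []

/-- A finite set containing all queries made in the first `t` steps. -/
def queries (O : J → List Bool → List Bool) (n : ℕ) (r : List Bool) (t : ℕ) :
    Finset (List Bool) :=
  (Finset.range t).image fun s => M.query (M.run O n r s)

theorem card_queries_le (O : J → List Bool → List Bool) (n : ℕ) (r : List Bool) (t : ℕ) :
    (M.queries O n r t).card ≤ t :=
  Finset.card_image_le.trans (Finset.card_range t).le

theorem step_congr {O O' : J → List Bool → List Bool} {c : M.Cfg}
    (h : ∀ j, O j (M.query c) = O' j (M.query c)) : M.step O c = M.step O' c := by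
  unfold query at h
  unfold step
  split <;> simp_all

/-- Oracles that agree on the queries lead to the same run. -/
theorem run_congr {O O' : J → List Bool → List Bool} {n : ℕ} {r : List Bool} {t : ℕ}
    (h : ∀ q ∈ M.queries O n r t, ∀ j, O j q = O' j q) : M.run O n r t = M.run O' n r t := by
  suffices ∀ s ≤ t, M.run O n r s = M.run O' n r s from this t le_rfl
  intro s
  induction s with
  | zero => intro _; rfl
  | succ s ih =>
    intro hs
    -- Both steps now start from the configuration of the run with `O`, whose queries are the ones
    -- controlled by `h`.
    rw [run_succ, run_succ, ← ih (Nat.le_of_succ_le hs)]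
    exact M.step_congr
      (h _ (Finset.mem_image_of_mem _ (Finset.mem_range.2 (Nat.lt_of_succ_le hs))))

end OracleMachine

/-! ### The distinguisher attached to a complement sampler -/

/-- Labels of the distinguisher: those of the sampler, those at which a query of the sampler has
been prefixed with `0`, and the final one. -/
inductive DistinguisherLabel (Λ : Type) : Type
  | simulate (l : Λ)
  | prefixed (l : Λ)
  | done

instance {Λ : Type} [Finite Λ] : Finite (DistinguisherLabel Λ) :=
  Finite.of_injective
    (fun l : DistinguisherLabel Λ => match l with
      | .simulate l => some (Sum.inl l)
      | .prefixed l => some (Sum.inr l)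
      | .done => (none : Option (Λ ⊕ Λ)))
    (by rintro (l | l | _) (l' | l' | _) h <;> simp_all)

/-- The program of the distinguisher: it runs the sampler, answering the query `i` by the forward
query `0i`, and finally replaces the output of the sampler by its preimage. -/
def distinguisherProg (M : OracleMachine Unit) :
    DistinguisherLabel M.Λ → Instr Direction M.K (DistinguisherLabel M.Λ)
  | .simulate l => match M.prog l with
    | .push k b l' => .push k b (.simulate l')
    | .pop k l' => .pop k (fun b => .simulate (l' b))
    | .ask _ k _ => .push k false (.prefixed l)
    | .halt => .ask .backward M.outputStack .done
  | .prefixed l => match M.prog l with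
    | .ask _ k l' => .ask .forward k (.simulate l')
    | _ => .halt
  | .done => .halt

/-- The oracle machine of the distinguisher. -/
noncomputable def distinguisherMachine (M : OracleMachine Unit) : OracleMachine Direction :=
  letI := M.finΛ
  { K := M.K
    decEqK := M.decEqK
    finK := M.finK
    Λ := DistinguisherLabel M.Λ
    finΛ := Fintype.ofFinite _
    inputStack := M.inputStack
    coinStack := M.coinStack
    outputStack := M.outputStack
    input_ne_coin := M.input_ne_coin
    start := .simulate M.start
    prog := distinguisherProg M }

/-- The configuration of the distinguisher that corresponds to one of the sampler. -/
def simulateCfg (M : OracleMachine Unit) (c : M.Cfg) : (distinguisherMachine M).Cfg :=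
  ⟨DistinguisherLabel.simulate c.label, c.stack⟩

/-- One step of the sampler is simulated in at most two steps. -/
theorem exists_iterate_step_simulateCfg (M : OracleMachine Unit) {n : ℕ}
    (σ : Equiv.Perm (Bits n)) (c : M.Cfg) :
    ∃ s ≤ 2, ((distinguisherMachine M).step (twoSidedOracle n σ))^[s] (simulateCfg M c) =
      simulateCfg M (M.step (indexOracle n σ) c) := by
  cases h : M.prog c.label with
  | push k b l =>
    refine ⟨1, by norm_num, ?_⟩
    simp [OracleMachine.step, distinguisherMachine, simulateCfg, distinguisherProg, h]
  | pop k l =>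
    refine ⟨1, by norm_num, ?_⟩
    simp [OracleMachine.step, distinguisherMachine, simulateCfg, distinguisherProg, h]
  | ask j k l =>
    refine ⟨2, le_rfl, ?_⟩
    simp [OracleMachine.step, distinguisherMachine, simulateCfg, distinguisherProg, h,
      twoSidedOracle, indexOracle]
  | halt =>
    -- A halted sampler stays put, whereas the distinguisher would go on to its backward query.
    refine ⟨0, by norm_num, ?_⟩
    simp [OracleMachine.step, h]

/-- The exact time depends on how many queries occur, since only these cost two steps. The bound
suffices because a halted machine keeps its configuration. -/
theorem exists_run_eq_simulateCfg (M : OracleMachine Unit) {n : ℕ}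
    (σ : Equiv.Perm (Bits n)) (r : List Bool) (t : ℕ) :
    ∃ s ≤ 2 * t, (distinguisherMachine M).run (twoSidedOracle n σ) n r s =
      simulateCfg M (M.run (indexOracle n σ) n r t) := by
  induction t with
  | zero => exact ⟨0, le_rfl, rfl⟩
  | succ t ih =>
    obtain ⟨s, hs, h⟩ := ih
    obtain ⟨s', hs', h'⟩ :=
      exists_iterate_step_simulateCfg M σ (M.run (indexOracle n σ) n r t)
    refine ⟨s' + s, by omega, ?_⟩
    rw [OracleMachine.run_succ, ← h', ← h]
    exact Function.iterate_add_apply _ _ _ _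

/-- The distinguisher halts one step after the simulation of a halting sampler. -/
theorem distinguisherMachine_run (M : OracleMachine Unit) {n : ℕ}
    (σ : Equiv.Perm (Bits n)) (r : List Bool) (t : ℕ)
    (h : M.Halted (M.run (indexOracle n σ) n r t)) :
    (distinguisherMachine M).Halted
        ((distinguisherMachine M).run (twoSidedOracle n σ) n r (2 * t + 1)) ∧
      ((distinguisherMachine M).run (twoSidedOracle n σ) n r (2 * t + 1)).stack M.outputStack =
        applyPerm σ.symm ((M.run (indexOracle n σ) n r t).stack M.outputStack) := by
  obtain ⟨s, hs, e⟩ := exists_run_eq_simulateCfg M σ r t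
  have e' := (distinguisherMachine M).run_succ (twoSidedOracle n σ) n r s
  rw [e] at e'
  unfold OracleMachine.Halted at h
  have hh : (distinguisherMachine M).Halted
      ((distinguisherMachine M).run (twoSidedOracle n σ) n r (s + 1)) := by
    rw [e']
    simp [OracleMachine.Halted, OracleMachine.step, distinguisherMachine, simulateCfg,
      distinguisherProg, h]
  rw [(distinguisherMachine M).run_eq_of_halted _ hh (show s + 1 ≤ 2 * t + 1 by omega)]
  refine ⟨hh, ?_⟩
  rw [e']
  simp only [OracleMachine.step, distinguisherMachine, simulateCfg, distinguisherProg, h,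
    twoSidedOracle]
  let := M.decEqK
  exact Function.update_self ..

/-- The distinguisher that accepts when the sampler succeeds. -/
noncomputable def distinguisher (A : PolyTimeAlgorithm indexOracle) :
    PolyTimeAlgorithm twoSidedOracle where
  toOracleMachine := distinguisherMachine A.toOracleMachine
  coins := A.coins
  time := 2 * A.time + 1
  halts n σ r := by
    have := (distinguisherMachine_run A.toOracleMachine σ r.toList _ (A.halts n σ r)).1
    simpa using this

theorem distinguisher_output (A : PolyTimeAlgorithm indexOracle) (n : ℕ)
    (σ : Equiv.Perm (Bits n)) (r : Bits (A.coins.eval n)) :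
    (distinguisher A).output n σ r = applyPerm σ.symm (A.output n σ r) := by
  have h := (distinguisherMachine_run A.toOracleMachine σ r.toList _ (A.halts n σ r)).2
  have ht : (distinguisher A).time.eval n = 2 * A.time.eval n + 1 := by
    simp [distinguisher]
  unfold PolyTimeAlgorithm.output
  rw [ht]
  exact h

theorem applyPerm_toList {n : ℕ} (σ : Equiv.Perm (Bits n)) (x : Bits n) :
    applyPerm σ x.toList = (σ x).toList :=
  dif_pos x.toList_length

/-! ### Complement samplers in terms of preimages -/

theorem samplesComplement_iff (A : PolyTimeAlgorithm indexOracle) (m : ℕ)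
    (σ : Equiv.Perm (Bits (m + 1))) (r : Bits (A.coins.eval (m + 1))) :
    SamplesComplement A (m + 1) σ r ↔
      ∃ j : Bits m, A.output (m + 1) σ r = (σ (true ::ᵥ j)).toList := by
  constructor
  · rintro ⟨y, hy, h⟩
    obtain ⟨x, rfl⟩ := σ.surjective y
    obtain ⟨b, j, rfl⟩ : ∃ b j, x = b ::ᵥ j := ⟨x.head, x.tail, (x.cons_head_tail).symm⟩
    cases b with
    | true => exact ⟨j, h⟩
    | false => exact absurd ⟨_, by simp, rfl⟩ hy
  · rintro ⟨j, h⟩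
    refine ⟨_, ?_, h⟩
    rintro ⟨x, hx, e⟩
    rw [σ.injective e] at hx
    simp at hx

theorem accepts_distinguisher_iff (A : PolyTimeAlgorithm indexOracle) (m : ℕ)
    (σ : Equiv.Perm (Bits (m + 1))) (r : Bits (A.coins.eval (m + 1))) :
    Accepts (distinguisher A) (m + 1) σ r ↔ SamplesComplement A (m + 1) σ r := by
  rw [samplesComplement_iff]
  unfold Accepts
  rw [distinguisher_output]
  constructor
  · intro h
    by_cases hy : (A.output (m + 1) σ r).length = m + 1
    · obtain ⟨y, hy⟩ : ∃ y : Bits (m + 1), A.output (m + 1) σ r = y.toList := ⟨⟨_, hy⟩, rfl⟩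
      obtain ⟨x, rfl⟩ := σ.surjective y
      rw [hy, applyPerm_toList, Equiv.symm_apply_apply] at h
      obtain ⟨b, j, rfl⟩ : ∃ b j, x = b ::ᵥ j := ⟨x.head, x.tail, (x.cons_head_tail).symm⟩
      obtain rfl : b = true := by simpa using h
      exact ⟨j, hy⟩
    -- A malformed output is answered by the empty string, so it is not accepted.
    · simp [applyPerm, hy] at h
  · rintro ⟨j, h⟩
    rw [h, applyPerm_toList, Equiv.symm_apply_apply]
    simp

/-! ### Truly random permutations -/

/-- Exchanging the preimage of an output in the complement with an index that is not queried does
not change the output. -/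
theorem output_mul_swap (A : PolyTimeAlgorithm indexOracle) (m : ℕ)
    (σ : Equiv.Perm (Bits (m + 1))) (r : Bits (A.coins.eval (m + 1))) (i j : Bits m)
    (hi : i.toList ∉
      A.queries (indexOracle (m + 1) σ) (m + 1) r.toList (A.time.eval (m + 1))) :
    A.output (m + 1) (σ * Equiv.swap (true ::ᵥ j) (false ::ᵥ i)) r = A.output (m + 1) σ r := by
  unfold PolyTimeAlgorithm.output
  rw [A.run_congr (O := indexOracle (m + 1) σ)
    (O' := indexOracle (m + 1) (σ * Equiv.swap (true ::ᵥ j) (false ::ᵥ i)))]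
  intro q hq _
  unfold indexOracle
  -- A query `x` of length `m` reads `σ` at `0x`, which is neither `1j` nor, as `i` is not queried,
  -- `0i`. Other lengths get the empty string from both oracles.
  by_cases h : q.length = m
  · obtain ⟨x, rfl⟩ : ∃ x : Bits m, q = x.toList := ⟨⟨q, h⟩, rfl⟩
    rw [← List.Vector.toList_cons, applyPerm_toList, applyPerm_toList, Equiv.Perm.mul_apply,
      Equiv.swap_apply_of_ne_of_ne]
    · intro e
      simpa using congrArg List.Vector.toList e
    · intro e
      have := congrArg List.Vector.toList e
      simp only [List.Vector.toList_cons, List.cons.injEq, true_and] at this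
      exact hi (this ▸ hq)
  · simp [applyPerm, h]

open Classical in
/-- Each success can be exchanged for a failure along every index that is not queried. -/
theorem card_samplesComplement_mul_le (A : PolyTimeAlgorithm indexOracle) (m : ℕ) :
    let Ω := Equiv.Perm (Bits (m + 1)) × Bits (A.coins.eval (m + 1))
    (Finset.univ.filter fun ω : Ω => SamplesComplement A (m + 1) ω.1 ω.2).card *
        (2 ^ m - A.time.eval (m + 1)) ≤
      (Finset.univ.filter fun ω : Ω => ¬ SamplesComplement A (m + 1) ω.1 ω.2).card * 2 ^ m := by
  intro Ω
  set T := A.time.eval (m + 1)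
  let U : Ω → Finset (Bits m) := fun ω => Finset.univ.filter fun i =>
    i.toList ∉ A.queries (indexOracle (m + 1) ω.1) (m + 1) ω.2.toList T
  have hU : ∀ ω, 2 ^ m - T ≤ (U ω).card := by
    intro ω
    have h1 : (Finset.univ.filter fun i : Bits m =>
        i.toList ∈ A.queries (indexOracle (m + 1) ω.1) (m + 1) ω.2.toList T).card ≤ T := by
      refine le_trans ?_ (A.card_queries_le (indexOracle (m + 1) ω.1) (m + 1) ω.2.toList T)
      refine Finset.card_le_card_of_injOn List.Vector.toList (fun i hi => ?_)
        (List.Vector.toList_injective.injOn)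
      simpa using hi
    have h2 := Finset.card_filter_add_card_filter_not (s := (Finset.univ : Finset (Bits m)))
      (fun i => i.toList ∈ A.queries (indexOracle (m + 1) ω.1) (m + 1) ω.2.toList T)
    have h3 : (Finset.univ : Finset (Bits m)).card = 2 ^ m := by simp [card_vector]
    change _ + (U ω).card = _ at h2
    omega
  set S := Finset.univ.filter fun ω : Ω => SamplesComplement A (m + 1) ω.1 ω.2 with hS
  have hj : ∀ ω : Ω, ∃ j : Bits m, ω ∈ S →
      A.output (m + 1) ω.1 ω.2 = (ω.1 (true ::ᵥ j)).toList := by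
    intro ω
    by_cases h : ω ∈ S
    · obtain ⟨j, hj⟩ := (samplesComplement_iff A m ω.1 ω.2).1 (Finset.mem_filter.1 h).2
      exact ⟨j, fun _ => hj⟩
    -- The value at failures is arbitrary; it only makes `j` a total function.
    · exact ⟨List.Vector.replicate m true, fun h' => absurd h' h⟩
  choose j hj using hj
  -- Recording `j` in the image allows the exchange to be undone.
  let f : (_ : Ω) × Bits m → Ω × Bits m := fun p =>
    ((p.1.1 * Equiv.swap (true ::ᵥ j p.1) (false ::ᵥ p.2), p.1.2), j p.1)
  have hout : ∀ p ∈ S.sigma U, A.output (m + 1) (f p).1.1 (f p).1.2 =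
      ((f p).1.1 (false ::ᵥ p.2)).toList := by
    rintro ⟨⟨σ, r⟩, i⟩ hp
    rw [Finset.mem_sigma] at hp
    have h1 := output_mul_swap A m σ r i (j (σ, r)) (Finset.mem_filter.1 hp.2).2
    refine h1.trans ((hj _ hp.1).trans ?_)
    simp [f]
  have hcard : (S.sigma U).card ≤ ((Finset.univ.filter fun ω : Ω =>
      ¬ SamplesComplement A (m + 1) ω.1 ω.2) ×ˢ (Finset.univ : Finset (Bits m))).card := by
    refine Finset.card_le_card_of_injOn f (fun p hp => ?_) ?_
    · have h := hout p hp
      simp only [Finset.coe_product, Set.mem_prod, Finset.mem_coe, Finset.mem_filter,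
        Finset.mem_univ, true_and, and_true, samplesComplement_iff]
      rintro ⟨k, hk⟩
      rw [h] at hk
      have := congrArg List.Vector.toList ((f p).1.1.injective (List.Vector.toList_injective hk))
      simp at this
    -- The output at the image is the value at `0i`, which recovers `i`; together with the recorded
    -- `j` this determines the transposition, which cancels.
    · rintro ⟨⟨σ, r⟩, i⟩ hp ⟨⟨σ', r'⟩, i'⟩ hp' e
      have h := hout _ hp
      have h' := hout _ hp'
      rw [← e, h] at h'
      have hi := congrArg List.Vector.toList
        ((f ⟨(σ, r), i⟩).1.1.injective (List.Vector.toList_injective h'))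
      obtain rfl : i = i' := List.Vector.toList_injective (by simpa using hi)
      have e1 : σ * Equiv.swap (true ::ᵥ j (σ, r)) (false ::ᵥ i) =
          σ' * Equiv.swap (true ::ᵥ j (σ', r')) (false ::ᵥ i) := congrArg (fun p => p.1.1) e
      have e2 : r = r' := congrArg (fun p => p.1.2) e
      have e3 : j (σ, r) = j (σ', r') := congrArg Prod.snd e
      rw [e3] at e1
      rw [mul_right_cancel e1, e2]
  rw [Finset.card_sigma, Finset.card_product] at hcard
  calc S.card * (2 ^ m - T) ≤ ∑ ω ∈ S, (U ω).card := by
        simpa using Finset.card_nsmul_le_sum S _ _ fun ω _ => hU ω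
    _ ≤ _ := hcard
    _ = _ := by simp [card_vector]

/-- Against a truly random permutation, a sampler that runs in time `T` succeeds with probability
at most `1 / 2 + T / 2 ^ n`. -/
theorem prob_samplesComplement_random_le (A : PolyTimeAlgorithm indexOracle) (m : ℕ) :
    prob (fun ω : Equiv.Perm (Bits (m + 1)) × Bits (A.coins.eval (m + 1)) =>
        SamplesComplement A (m + 1) ω.1 ω.2) ≤
      1 / 2 + ((A.time.eval (m + 1) : ℕ) : ℝ) / 2 ^ (m + 1) := by
  classical
  have h := card_samplesComplement_mul_le A m
  simp only at h
  have hadd := Finset.card_filter_add_card_filter_not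
    (s := (Finset.univ : Finset (Equiv.Perm (Bits (m + 1)) × Bits (A.coins.eval (m + 1)))))
    (fun ω => SamplesComplement A (m + 1) ω.1 ω.2)
  unfold prob
  rw [Finset.card_univ] at hadd
  have hpos : 0 < Fintype.card (Equiv.Perm (Bits (m + 1)) × Bits (A.coins.eval (m + 1))) :=
    Fintype.card_pos_iff.2 ⟨(1, List.Vector.replicate _ true)⟩
  convert_to ((Finset.univ.filter fun ω :
    Equiv.Perm (Bits (m + 1)) × Bits (A.coins.eval (m + 1)) =>
      SamplesComplement A (m + 1) ω.1 ω.2).card : ℝ) / _ ≤ _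
  generalize (Finset.univ.filter fun ω :
    Equiv.Perm (Bits (m + 1)) × Bits (A.coins.eval (m + 1)) =>
      SamplesComplement A (m + 1) ω.1 ω.2).card = s at *
  generalize (Finset.univ.filter fun ω :
    Equiv.Perm (Bits (m + 1)) × Bits (A.coins.eval (m + 1)) =>
      ¬ SamplesComplement A (m + 1) ω.1 ω.2).card = f at *
  generalize Fintype.card (Equiv.Perm (Bits (m + 1)) × Bits (A.coins.eval (m + 1))) = N at *
  generalize A.time.eval (m + 1) = T at *
  subst hadd
  have hR : (s : ℝ) * (2 ^ m - T) ≤ f * 2 ^ m := by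
    -- Truncated subtraction dominates real subtraction, so `T > 2 ^ m` needs no separate case.
    have h1 : (2 ^ m - T : ℝ) ≤ ((2 ^ m - T : ℕ) : ℝ) := by
      have h2 : ((2 ^ m : ℕ) : ℝ) ≤ ((2 ^ m - T + T : ℕ) : ℝ) := Nat.cast_le.2 le_tsub_add
      push_cast at h2
      linarith
    calc (s : ℝ) * (2 ^ m - T) ≤ s * ((2 ^ m - T : ℕ) : ℝ) := by gcongr
      _ ≤ f * 2 ^ m := by exact_mod_cast h
  have hN : (0 : ℝ) < ((s + f : ℕ) : ℝ) := by exact_mod_cast hpos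
  have h2 : (0 : ℝ) < 2 ^ m := by positivity
  rw [div_le_iff₀ hN, pow_succ]
  -- Weakens the error `s * T` to `(s + f) * T`, so that dividing by `s + f` leaves `T`.
  have hf : (0 : ℝ) ≤ f * T := by positivity
  have key : (s : ℝ) * (2 ^ m * 2) ≤ (s + f) * 2 ^ m + (s + f) * T := by nlinarith
  have : (1 / 2 + (T : ℝ) / (2 ^ m * 2)) * ((s + f : ℕ) : ℝ) =
      ((s + f) * 2 ^ m + (s + f) * T) / (2 ^ m * 2) := by
    push_cast
    field_simp
  rw [this, le_div_iff₀ (by positivity)]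
  exact key

/-! ### Negligibility of the error and conclusion -/

theorem negligible_polynomial_div_two_pow (p : Polynomial ℕ) :
    Negligible fun n => ((p.eval n : ℕ) : ℝ) / 2 ^ n := by
  have h : Negligible fun n => ((2 : ℝ) ^ n)⁻¹ := fun c => by
    simpa [div_eq_mul_inv] using
      tendsto_pow_const_div_const_pow_of_one_lt c (one_lt_two (α := ℝ))
  refine (h.polynomial_mul (p.map (Nat.castRingHom ℝ))).congr fun n => ?_
  rw [div_eq_mul_inv, Polynomial.eval_natCast_map]
  simp

end ComplementSampling

open ComplementSampling in
theorem mainTheorem3 (P : KeyedPermutation) (hP : IsStrongPRP P)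
    (A : PolyTimeAlgorithm indexOracle) :
    ∃ ν : ℕ → ℝ, Negligible ν ∧ ∀ n : ℕ, 1 ≤ n →
      prob (fun ω : Bits n × Bits (A.coins.eval n) => SamplesComplement A n (P n ω.1) ω.2)
        ≤ 1 / 2 + ν n := by
  obtain ⟨ν, hν, h⟩ := hP.indistinguishable (distinguisher A)
  refine ⟨fun n => ν n + ((A.time.eval n : ℕ) : ℝ) / 2 ^ n,
    hν.add (negligible_polynomial_div_two_pow A.time), fun n hn => ?_⟩
  obtain ⟨m, rfl⟩ := Nat.exists_eq_add_of_le' hn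
  have h1 := (le_abs_self _).trans (h (m + 1))
  have h2 := prob_samplesComplement_random_le A m
  have e (σ : Equiv.Perm (Bits (m + 1))) (r : Bits (A.coins.eval (m + 1))) :=
    propext (accepts_distinguisher_iff A m σ r)
  -- The distinguisher uses the coins of `A` by definition, so both probabilities live on the
  -- sampler's space.
  change prob (fun ω : Bits (m + 1) × Bits (A.coins.eval (m + 1)) =>
    Accepts (distinguisher A) (m + 1) (P (m + 1) ω.1) ω.2) - prob (fun ω :
      Equiv.Perm (Bits (m + 1)) × Bits (A.coins.eval (m + 1)) =>
        Accepts (distinguisher A) (m + 1) ω.1 ω.2) ≤ _ at h1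
  simp only [e] at h1
  dsimp only
  linarith
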